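/- Consider a library of $N$ files and a cache that fits $C$ of them, with $C<N/2$, and put $\gamma=C/N$. The configurations are the $y\in\mathcal Y=\{y\in[0,1]^N:\sum_n y^n\le C\}$. In each slot $t$ a caching policy $\sigma$, possibly randomized, chooses $y_t(\sigma)\in\mathcal Y$ from the past requests and past configurations; then one file $n$ is requested, which is encoded by the unit vector $x_t=e_n$, and the utility $f_t(y_t)=w\sum_n x_t^n y_t^n$ is obtained, where $w>0$ is the same for all files. The regret of $\sigma$ over the horizon $T$ is $$R_T(\sigma)=\max_{P}\ \mathbb E\Big[\max_{y\in\mathcal Y}\sum_{t=1}^T f_t(y)-\sum_{t=1}^T f_t(y_t(\sigma))\Big],$$ the maximum being over all joint distributions $P$ of $(x_1,\dots,x_T)$. Online gradient ascent (OGA) starts at some $y_1\in\mathcal Y$ and sets $y_{t+1}=\Pi_{\mathcal Y}(y_t+\eta\, w\, x_t)$, where $\Pi_{\mathcal Y}$ is the Euclidean projection onto $\mathcal Y$ and $\eta=\operatorname{diam}(\mathcal Y)/(w\sqrt T)$. Then the minimum of $R_T(\sigma)$ over all caching policies $\sigma$ is attained for every $T$, and for all sufficiently large $T$ (depending on $N$,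 $C$, $w$) $$w\sqrt{\frac{\gamma}{\pi}}\,\sqrt{CT}\ \le\ \min_\sigma R_T(\sigma)\ \le\ w\sqrt2\,\sqrt{CT}.$$ For every $y_1\in\mathcal Y$, the policy OGA satisfies $R_T(\mathrm{OGA})\le w\sqrt2\sqrt{CT}$ for all sufficiently large $T$. Hence the regret of online caching is $\Theta(\sqrt{CT})$ and OGA is order-optimal: for fixed $\gamma$ and $w$ there are constants $c_1,c_2,K>0$ such that for all $N,C$ with $C/N=\gamma$ and $C<N/2$, we have $c_1\sqrt{CT}\le\min_\sigma R_T(\sigma)\le c_2\sqrt{CT}$ for all sufficiently large $T$, and, for every $y_1\in\mathcal Y$, $R_T(\mathrm{OGA})\le K\min_\sigma R_T(\sigma)$ for all sufficiently large $T$. -/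

import Mathlib

open MeasureTheory ProbabilityTheory Filter Topology

noncomputable section

namespace OnlineCaching

/-- Admissible cache configurations: fractions of the `N` files, of total size at most `C`. -/
def cacheSet (N C : ℕ) : Set (EuclideanSpace ℝ (Fin N)) :=
  {y | (∀ n, 0 ≤ y n ∧ y n ≤ 1) ∧ ∑ n, y n ≤ (C : ℝ)}

/-- The request vector `eᵢ` of a slot in which file `i` is requested. A request is encoded by
the index `i` of the requested file. -/
def requestVector {N : ℕ} (i : Fin N) : EuclideanSpace ℝ (Fin N) :=
  EuclideanSpace.single i 1

/-- The utility `f(x, y) = ∑ₙ wⁿ xⁿ yⁿ` of configuration `y` when file `i` is requested. -/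
def utility {N : ℕ} (w : Fin N → ℝ) (i : Fin N) (y : EuclideanSpace ℝ (Fin N)) : ℝ :=
  ∑ n, w n * requestVector i n * y n

/-- A (possibly randomized) caching policy. Slots are numbered from `0`; in slot `t`, the
requests and the configurations of the slots before `t` are mapped to the probability law of
the configuration of slot `t`. -/
structure CachingPolicy (N C : ℕ) where
  rule : (t : ℕ) → Kernel ((Fin t → Fin N) × (Fin t → cacheSet N C)) (cacheSet N C)
  markov : ∀ t, IsMarkovKernel (rule t)

/-- The joint law of the configurations of the first `t` slots under the policy `σ` when the
requests of these slots are `x`. -/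
def CachingPolicy.law {N C : ℕ} (σ : CachingPolicy N C) :
    (t : ℕ) → (Fin t → Fin N) → Measure (Fin t → cacheSet N C)
  | 0, _ => Measure.dirac Fin.elim0
  | t + 1, x =>
      (σ.law t (Fin.init x) ⊗ₘ
        (σ.rule t).comap (fun y => (Fin.init x, y)) measurable_prodMk_left).map
      (fun p : (Fin t → cacheSet N C) × cacheSet N C =>
        (Fin.snoc p.1 p.2 : Fin (t + 1) → cacheSet N C))

/-- The utility over the slots of `x` of the best static configuration in hindsight. -/
def bestStatic {N : ℕ} (C : ℕ) (w : Fin N → ℝ) {T : ℕ} (x : Fin T → Fin N) : ℝ :=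
  ⨆ y : cacheSet N C, ∑ t, utility w (x t) y

/-- The expected utility loss of `σ` with respect to the best static configuration in
hindsight, when the requests are drawn from the joint distribution `P`. -/
def expectedLoss {N C : ℕ} (w : Fin N → ℝ) (σ : CachingPolicy N C) {T : ℕ}
    (P : PMF (Fin T → Fin N)) : ℝ :=
  ∑ x, (P x).toReal *
    ∫ y, (bestStatic C w x - ∑ t, utility w (x t) (y t)) ∂(σ.law T x)

/-- The regret `R_T(σ)`: the largest expected loss over all joint request distributions. -/
def regret {N C : ℕ} (w : Fin N → ℝ) (T : ℕ) (σ : CachingPolicy N C) : ℝ :=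
  ⨆ P : PMF (Fin T → Fin N), expectedLoss w σ P

/-- The infimum of the regret over all caching policies. -/
def minRegret (N C : ℕ) (w : Fin N → ℝ) (T : ℕ) : ℝ :=
  ⨅ σ : CachingPolicy N C, regret w T σ

/-- Every point has a nearest admissible configuration. -/
theorem exists_nearest (N C : ℕ) (z : EuclideanSpace ℝ (Fin N)) :
    ∃ y : cacheSet N C, ∀ y' : cacheSet N C,
      ‖z - (y : EuclideanSpace ℝ (Fin N))‖ ≤ ‖z - (y' : EuclideanSpace ℝ (Fin N))‖ := by
  have hn (n : Fin N) : Continuous fun y : EuclideanSpace ℝ (Fin N) => y n := by fun_prop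
  have hs : Continuous fun y : EuclideanSpace ℝ (Fin N) => ∑ n, y n := by fun_prop
  have hcl : IsClosed (cacheSet N C) := by
    have hrw : cacheSet N C =
        (⋂ n, ({y : EuclideanSpace ℝ (Fin N) | 0 ≤ y n} ∩ {y | y n ≤ 1})) ∩
          {y | ∑ n, y n ≤ (C : ℝ)} := by
      ext y; simp [cacheSet]
    rw [hrw]
    exact (isClosed_iInter fun n => (isClosed_le continuous_const (hn n)).inter
      (isClosed_le (hn n) continuous_const)).inter (isClosed_le hs continuous_const)
  have hne : (cacheSet N C).Nonempty := ⟨0, by simp [cacheSet]⟩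
  obtain ⟨y, hy, h⟩ := hcl.exists_infDist_eq_dist hne z
  refine ⟨⟨y, hy⟩, fun y' => ?_⟩
  rw [← dist_eq_norm, ← dist_eq_norm, ← h]
  exact Metric.infDist_le_dist_of_mem y'.2

/-- The Euclidean projection onto the set of admissible configurations. -/
def proj {N : ℕ} (C : ℕ) (z : EuclideanSpace ℝ (Fin N)) : cacheSet N C :=
  (exists_nearest N C z).choose

/-- The gradient `(wⁿ xⁿ)ₙ` of the utility when file `i` is requested. -/
def utilityGradient {N : ℕ} (w : Fin N → ℝ) (i : Fin N) : EuclideanSpace ℝ (Fin N) :=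
  WithLp.toLp 2 fun n => w n * requestVector i n

/-- The configuration of online gradient ascent after the requests `x`, with initial
configuration `y₁` and stepsizes `η`. -/
def ogaConfig {N C : ℕ} (w : Fin N → ℝ) (η : ℕ → ℝ) (y₁ : cacheSet N C) :
    (t : ℕ) → (Fin t → Fin N) → cacheSet N C
  | 0, _ => y₁
  | t + 1, x =>
      proj C ((ogaConfig w η y₁ t (Fin.init x) : EuclideanSpace ℝ (Fin N)) +
        η t • utilityGradient w (x (Fin.last t)))

/-- Online gradient ascent as a (deterministic) caching policy. -/
def oga {N C : ℕ} (w : Fin N → ℝ) (η : ℕ → ℝ) (y₁ : cacheSet N C) : CachingPolicy N C where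
  rule t := Kernel.deterministic (fun h => ogaConfig w η y₁ t h.1)
    ((measurable_of_finite (ogaConfig w η y₁ t)).comp measurable_fst)
  markov _ := inferInstance

/-- Online gradient ascent tuned to the horizon `T` by the constant stepsize
`diam / (L √T)`, where `L` bounds the norms of the gradients. -/
def ogaTuned {N C : ℕ} (w : Fin N → ℝ) (L : ℝ) (T : ℕ) (y₁ : cacheSet N C) :
    CachingPolicy N C :=
  oga w (fun _ => Metric.diam (cacheSet N C) / (L * √(T : ℝ))) y₁

end OnlineCaching

end

noncomputable section

namespace OnlineCaching

/-! The utility is linear in the configuration and the expected loss is linear in the request law.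
Hence a randomized policy may be replaced by its mean configurations and the adversary by a single
worst request sequence (`regret_eq`). Up to the horizon a policy is then a point of a finite product
of compact sets, so the minimum is attained.

The upper bound is the potential argument for projected gradient ascent, with the squared distance
to a fixed competitor as potential (`ogaConfig_potential`), combined with `diam_cacheSet_le`.

For the lower bound, `2 * C` files are grouped into `C` pairs and requested uniformly and
independently. Every policy earns on average at most `w / 2` per slot (`sum_words_le`), while
hindsight caches the more requested file of each pair and gains half of the absolute count
difference (`le_bestStatic`). By the central limit theorem each difference has mean absolute value
about `√(2 / π) * √(T / C)`. Summing over the pairs gives every constant below `w / 2 * √(2 / π)`,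
and `γ < 1 / 2` puts the claimed constant strictly below it. -/

variable {N C : ℕ}

/-! ### Utility and geometry of the configuration set. -/

theorem utility_eq (w : Fin N → ℝ) (i : Fin N) (y : EuclideanSpace ℝ (Fin N)) :
    utility w i y = w i * y i := by
  simp [utility, requestVector]

theorem continuous_utility (w : Fin N → ℝ) (i : Fin N) : Continuous (utility w i) := by
  have : utility w i = fun y => w i * y i := funext (utility_eq w i)
  rw [this]
  fun_prop

theorem isClosed_cacheSet (N C : ℕ) : IsClosed (cacheSet N C) := by
  have hrw : cacheSet N C =
      (⋂ n, ({y : EuclideanSpace ℝ (Fin N) | 0 ≤ y n} ∩ {y | y n ≤ 1})) ∩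
        {y | ∑ n, y n ≤ (C : ℝ)} := by
    ext y; simp [cacheSet]
  rw [hrw]
  exact (isClosed_iInter fun n => (isClosed_le (by fun_prop) (by fun_prop)).inter
    (isClosed_le (by fun_prop) (by fun_prop))).inter (isClosed_le (by fun_prop) (by fun_prop))

theorem convex_cacheSet (N C : ℕ) : Convex ℝ (cacheSet N C) := by
  rintro y ⟨hy, hyC⟩ z ⟨hz, hzC⟩ a b ha hb hab
  refine ⟨fun n => ⟨?_, ?_⟩, ?_⟩
  · simp only [PiLp.add_apply, PiLp.smul_apply, smul_eq_mul]
    have := (hy n).1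
    have := (hz n).1
    positivity
  · simp only [PiLp.add_apply, PiLp.smul_apply, smul_eq_mul]
    nlinarith [mul_le_mul_of_nonneg_left (hy n).2 ha, mul_le_mul_of_nonneg_left (hz n).2 hb]
  · simp only [PiLp.add_apply, PiLp.smul_apply, smul_eq_mul, Finset.sum_add_distrib,
      ← Finset.mul_sum]
    nlinarith [mul_le_mul_of_nonneg_left hyC ha, mul_le_mul_of_nonneg_left hzC hb]

/-- For `a, b` in `[0, 1]`, `(a - b) ^ 2 ≤ a ^ 2 + b ^ 2 ≤ a + b`; the capacity constraint then
bounds both sums. -/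
theorem norm_sub_sq_le {y z : EuclideanSpace ℝ (Fin N)} (hy : y ∈ cacheSet N C)
    (hz : z ∈ cacheSet N C) : ‖y - z‖ ^ 2 ≤ 2 * C := by
  rw [EuclideanSpace.norm_sq_eq]
  calc ∑ n, ‖(y - z) n‖ ^ 2 ≤ ∑ n, (y n + z n) := by
        refine Finset.sum_le_sum fun n _ => ?_
        have h1 := hy.1 n
        have h2 := hz.1 n
        simp only [PiLp.sub_apply, Real.norm_eq_abs, sq_abs]
        nlinarith
    _ ≤ 2 * C := by
        rw [Finset.sum_add_distrib]
        linarith [hy.2, hz.2]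

theorem dist_le_sqrt {y z : EuclideanSpace ℝ (Fin N)} (hy : y ∈ cacheSet N C)
    (hz : z ∈ cacheSet N C) : dist y z ≤ √(2 * C) := by
  rw [dist_eq_norm]
  exact Real.le_sqrt_of_sq_le (norm_sub_sq_le hy hz)

theorem isBounded_cacheSet (N C : ℕ) : Bornology.IsBounded (cacheSet N C) :=
  Metric.isBounded_iff.2 ⟨_, fun _ hy _ hz => dist_le_sqrt hy hz⟩

theorem diam_cacheSet_le (N C : ℕ) : Metric.diam (cacheSet N C) ≤ √(2 * C) :=
  Metric.diam_le_of_forall_dist_le (Real.sqrt_nonneg _) fun _ hy _ hz => dist_le_sqrt hy hz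

instance : CompactSpace (cacheSet N C) :=
  isCompact_iff_compactSpace.1
    (Metric.isCompact_of_isClosed_isBounded (isClosed_cacheSet N C) (isBounded_cacheSet N C))

instance : Nonempty (cacheSet N C) := ⟨⟨0, by simp [cacheSet]⟩⟩

theorem integrable_of_continuous {E : Type*} [NormedAddCommGroup E] {μ : Measure (cacheSet N C)}
    [IsFiniteMeasure μ] {f : cacheSet N C → E} (hf : Continuous f) : Integrable f μ :=
  hf.integrable_of_hasCompactSupport (HasCompactSupport.of_compactSpace f)

theorem measurable_snoc (t : ℕ) :
    Measurable fun p : (Fin t → cacheSet N C) × cacheSet N C =>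
      (Fin.snoc p.1 p.2 : Fin (t + 1) → cacheSet N C) := by
  refine measurable_pi_iff.2 fun i => ?_
  induction i using Fin.lastCases with
  | last => simpa using measurable_snd
  | cast i =>
    simp only [Fin.snoc_castSucc]
    fun_prop

/-! ### Randomized policies: slot marginals and mean configurations. -/

namespace CachingPolicy

variable (σ : CachingPolicy N C)

/-- The law of the next configuration of `σ` after the requests `x`, given the past
configurations. -/
def stepKernel (t : ℕ) (x : Fin t → Fin N) : Kernel (Fin t → cacheSet N C) (cacheSet N C) :=
  (σ.rule t).comap (fun y => (x, y)) measurable_prodMk_left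

instance (t : ℕ) (x : Fin t → Fin N) : IsMarkovKernel (σ.stepKernel t x) :=
  have := σ.markov t
  Kernel.IsMarkovKernel.comap _ _

instance isProbabilityMeasure_law : ∀ (t : ℕ) (x : Fin t → Fin N),
    IsProbabilityMeasure (σ.law t x)
  | 0, _ => inferInstanceAs (IsProbabilityMeasure (Measure.dirac _))
  | t + 1, x => by
    have := isProbabilityMeasure_law t (Fin.init x)
    exact Measure.isProbabilityMeasure_map
      (μ := σ.law t (Fin.init x) ⊗ₘ σ.stepKernel t (Fin.init x)) (measurable_snoc t).aemeasurable

/-- The law of the configuration of slot `t` under `σ` after the requests `x`. -/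
def slotLaw (t : ℕ) (x : Fin t → Fin N) : Measure (cacheSet N C) :=
  (σ.law t x ⊗ₘ σ.stepKernel t x).map Prod.snd

instance (t : ℕ) (x : Fin t → Fin N) : IsProbabilityMeasure (σ.slotLaw t x) :=
  Measure.isProbabilityMeasure_map measurable_snd.aemeasurable

theorem integrable_law {T : ℕ} (x : Fin T → Fin N) (g : Fin T → cacheSet N C → ℝ)
    (hg : ∀ t, Continuous (g t)) : Integrable (fun y => ∑ t, g t (y t)) (σ.law T x) := by
  refine integrable_finsetSum _ fun t _ => ?_
  have h := measurable_pi_apply (X := fun _ : Fin T => cacheSet N C) t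
  have := Measure.isProbabilityMeasure_map (μ := σ.law T x) h.aemeasurable
  exact (integrable_of_continuous (hg t)).comp_measurable h

/-- Additive functionals see only the slot marginals, so correlations between slots play no role. -/
theorem integral_law {T : ℕ} (x : Fin T → Fin N) (g : Fin T → cacheSet N C → ℝ)
    (hg : ∀ t, Continuous (g t)) :
    ∫ y, ∑ t, g t (y t) ∂(σ.law T x) =
      ∑ t : Fin T, ∫ z, g t z ∂(σ.slotLaw t fun s => x (s.castLE t.2.le)) := by
  induction T with
  | zero => simp
  | succ T IH =>
    have hlaw : σ.law (T + 1) x = (σ.law T (Fin.init x) ⊗ₘ σ.stepKernel T (Fin.init x)).map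
        (fun p => (Fin.snoc p.1 p.2 : Fin (T + 1) → cacheSet N C)) := rfl
    have hfst : (σ.law T (Fin.init x) ⊗ₘ σ.stepKernel T (Fin.init x)).map Prod.fst =
        σ.law T (Fin.init x) := Measure.fst_compProd _ _
    have hi1 := σ.integrable_law (Fin.init x) (fun t => g t.castSucc) fun t => hg _
    have hi2 : Integrable (g (Fin.last T)) (σ.slotLaw T (Fin.init x)) :=
      integrable_of_continuous (hg _)
    have ih := IH (Fin.init x) (fun t => g t.castSucc) fun t => hg _
    have hm : AEStronglyMeasurable (fun y => ∑ t, g t (y t)) (σ.law (T + 1) x) :=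
      (σ.integrable_law x g hg).aestronglyMeasurable
    rw [hlaw] at hm ⊢
    rw [integral_map (measurable_snoc T).aemeasurable hm]
    simp only [Fin.sum_univ_castSucc, Fin.snoc_castSucc, Fin.snoc_last]
    rw [integral_add]
    · congr 1
      · refine Eq.trans ?_ ih
        conv_rhs => rw [← hfst]
        rw [integral_map measurable_fst.aemeasurable]
        rw [hfst]
        exact hi1.aestronglyMeasurable
      · exact (integral_map measurable_snd.aemeasurable hi2.aestronglyMeasurable).symm
    · rw [← hfst] at hi1
      exact hi1.comp_measurable measurable_fst
    · exact hi2.comp_measurable measurable_snd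

/-- The mean configuration of slot `t` under `σ` after the requests `x`. -/
def meanConfig (t : ℕ) (x : Fin t → Fin N) : cacheSet N C :=
  ⟨∫ z, (z : EuclideanSpace ℝ (Fin N)) ∂(σ.slotLaw t x),
    (convex_cacheSet N C).integral_mem (isClosed_cacheSet N C) (ae_of_all _ fun z => z.2)
      (integrable_of_continuous continuous_subtype_val)⟩

theorem integral_utility (w : Fin N → ℝ) (i : Fin N) (t : ℕ) (x : Fin t → Fin N) :
    ∫ z : cacheSet N C, utility w i z ∂(σ.slotLaw t x) = utility w i (σ.meanConfig t x) := by
  simp only [utility_eq, meanConfig, integral_const_mul]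
  congr 1
  exact (EuclideanSpace.proj (𝕜 := ℝ) i).integral_comp_comm
    (integrable_of_continuous continuous_subtype_val)

end CachingPolicy

/-! ### Reduction to deterministic strategies, and the attained minimum. -/

/-- The loss, with respect to the best static configuration in hindsight, of the deterministic
policy that plays `m` when the requests are `x`. -/
def trackingLoss (w : Fin N → ℝ) (m : (t : ℕ) → (Fin t → Fin N) → cacheSet N C) {T : ℕ}
    (x : Fin T → Fin N) : ℝ :=
  bestStatic C w x - ∑ t : Fin T, utility w (x t) (m t fun s => x (s.castLE t.2.le))

theorem expectedLoss_eq (w : Fin N → ℝ) (σ : CachingPolicy N C) {T : ℕ}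
    (P : PMF (Fin T → Fin N)) :
    expectedLoss w σ P = ∑ x, (P x).toReal * trackingLoss w σ.meanConfig x := by
  refine Finset.sum_congr rfl fun x _ => ?_
  have hg : ∀ t, Continuous fun z : cacheSet N C => utility w (x t) z :=
    fun t => (continuous_utility w (x t)).comp continuous_subtype_val
  rw [integral_sub (integrable_const _) (σ.integrable_law x _ hg), σ.integral_law x _ hg]
  simp [trackingLoss, CachingPolicy.integral_utility]

/-- An average over `P` is at most the maximum, and point masses reach it. -/
theorem regret_eq [NeZero N] (w : Fin N → ℝ) (T : ℕ) (σ : CachingPolicy N C) :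
    regret w T σ = ⨆ x : Fin T → Fin N, trackingLoss w σ.meanConfig x := by
  have hle (P : PMF (Fin T → Fin N)) :
      expectedLoss w σ P ≤ ⨆ x : Fin T → Fin N, trackingLoss w σ.meanConfig x := by
    rw [expectedLoss_eq]
    have hP : ∑ x, (P x).toReal = 1 := by
      rw [← ENNReal.toReal_sum fun x _ => P.apply_ne_top x, ← tsum_fintype (L := .unconditional _),
        P.tsum_coe, ENNReal.toReal_one]
    calc ∑ x, (P x).toReal * trackingLoss w σ.meanConfig x
        ≤ ∑ x, (P x).toReal * ⨆ x : Fin T → Fin N, trackingLoss w σ.meanConfig x :=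
          Finset.sum_le_sum fun x _ => mul_le_mul_of_nonneg_left
            (le_ciSup (Set.finite_range _).bddAbove x) ENNReal.toReal_nonneg
      _ = _ := by rw [← Finset.sum_mul, hP, one_mul]
  have : Nonempty (PMF (Fin T → Fin N)) := ⟨PMF.pure 0⟩
  refine le_antisymm (ciSup_le hle) (ciSup_le fun x => ?_)
  refine le_ciSup_of_le ⟨_, Set.forall_mem_range.2 hle⟩ (PMF.pure x) ?_
  classical
  rw [expectedLoss_eq, Finset.sum_eq_single x]
  · simp
  · intro b _ hb
    simp [PMF.pure_apply, hb]
  · simp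

/-- The policy that plays `m` deterministically. -/
def detPolicy (m : (t : ℕ) → (Fin t → Fin N) → cacheSet N C) : CachingPolicy N C where
  rule t := Kernel.deterministic (fun h => m t h.1)
    ((measurable_of_finite (m t)).comp measurable_fst)
  markov _ := inferInstance

theorem meanConfig_detPolicy (m : (t : ℕ) → (Fin t → Fin N) → cacheSet N C) :
    (detPolicy m).meanConfig = m := by
  funext t x
  have hk : (detPolicy m).stepKernel t x = Kernel.const _ (Measure.dirac (m t x)) := by
    ext y : 1
    simp [CachingPolicy.stepKernel, detPolicy, Kernel.deterministic_apply]
  refine Subtype.ext ?_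
  simp [CachingPolicy.meanConfig, CachingPolicy.slotLaw, hk]

theorem oga_eq_detPolicy (w : Fin N → ℝ) (η : ℕ → ℝ) (y₁ : cacheSet N C) :
    oga w η y₁ = detPolicy (ogaConfig w η y₁) := rfl

/-- Histories up to the horizon are finite in number, so the strategies form a compact product, on
which the worst-case loss is a maximum of finitely many continuous functions. -/
theorem exists_regret_le [NeZero N] (w : Fin N → ℝ) (T : ℕ) :
    ∃ σ₀ : CachingPolicy N C, ∀ σ : CachingPolicy N C, regret w T σ₀ ≤ regret w T σ := by
  -- Slots from `T` on do not affect the loss and get an arbitrary configuration.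
  let ext (m : (t : Fin T) → (Fin t → Fin N) → cacheSet N C) (t : ℕ) (x : Fin t → Fin N) :
      cacheSet N C := if h : t < T then m ⟨t, h⟩ x else Classical.arbitrary _
  have hext (m : (t : ℕ) → (Fin t → Fin N) → cacheSet N C) (x : Fin T → Fin N) :
      trackingLoss w (ext fun t => m t) x = trackingLoss w m x := by
    simp [trackingLoss, ext]
  have hcont : Continuous fun m => ⨆ x : Fin T → Fin N, trackingLoss w (ext m) x := by
    simp only [← Finset.sup'_univ_eq_ciSup]
    refine Continuous.finset_sup'_apply _ fun x _ => continuous_const.sub ?_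
    refine continuous_finsetSum _ fun t _ => (continuous_utility w (x t)).comp ?_
    simp only [ext, t.2, dite_true]
    fun_prop
  obtain ⟨m₀, -, hm₀⟩ := isCompact_univ.exists_isMinOn Set.univ_nonempty hcont.continuousOn
  refine ⟨detPolicy (ext m₀), fun σ => ?_⟩
  rw [regret_eq, regret_eq, meanConfig_detPolicy]
  have h := isMinOn_univ_iff.1 hm₀ fun t => σ.meanConfig t
  simpa only [hext] using h

theorem isLeast_minRegret [NeZero N] (w : Fin N → ℝ) (T : ℕ) :
    IsLeast (Set.range (regret (N := N) (C := C) w T)) (minRegret N C w T) := by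
  obtain ⟨σ₀, h⟩ := exists_regret_le (C := C) w T
  have : minRegret N C w T = regret w T σ₀ :=
    have : Nonempty (CachingPolicy N C) := ⟨σ₀⟩
    le_antisymm (ciInf_le ⟨_, Set.forall_mem_range.2 h⟩ σ₀) (le_ciInf h)
  rw [this]
  exact ⟨⟨σ₀, rfl⟩, Set.forall_mem_range.2 h⟩

/-! ### Upper bound: online gradient ascent. -/

theorem norm_proj_sub_sq_le (z : EuclideanSpace ℝ (Fin N)) {u : EuclideanSpace ℝ (Fin N)}
    (hu : u ∈ cacheSet N C) : ‖(proj C z : EuclideanSpace ℝ (Fin N)) - u‖ ^ 2 ≤ ‖z - u‖ ^ 2 := by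
  set p : EuclideanSpace ℝ (Fin N) := (proj C z : EuclideanSpace ℝ (Fin N)) with hp
  have hmin : ‖z - p‖ = ⨅ y : cacheSet N C, ‖z - y‖ :=
    le_antisymm (le_ciInf (exists_nearest N C z).choose_spec)
      (ciInf_le ⟨0, Set.forall_mem_range.2 fun _ => norm_nonneg _⟩ (proj C z))
  have hinner := (norm_eq_iInf_iff_real_inner_le_zero (convex_cacheSet N C) (proj C z).2).1 hmin u hu
  have hsplit : z - u = (z - p) - (u - p) := by abel
  rw [hsplit, norm_sub_sq_real (z - p), norm_sub_rev p u]
  nlinarith [sq_nonneg ‖z - p‖]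

theorem inner_utilityGradient (w : Fin N → ℝ) (i : Fin N) (y : EuclideanSpace ℝ (Fin N)) :
    inner ℝ (utilityGradient w i) y = utility w i y := by
  simp [utilityGradient, utility, PiLp.inner_apply, mul_comm]

theorem utility_sub (w : Fin N → ℝ) (i : Fin N) (y z : EuclideanSpace ℝ (Fin N)) :
    utility w i (y - z) = utility w i y - utility w i z := by
  simp [utility_eq, mul_sub]

theorem norm_utilityGradient_sq (w : Fin N → ℝ) (i : Fin N) :
    ‖utilityGradient w i‖ ^ 2 = w i ^ 2 := by
  rw [← real_inner_self_eq_norm_sq, inner_utilityGradient, utility_eq]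
  simp [utilityGradient, requestVector, sq]

/-- Expanding the square of a step gives the utility gap as cross term and at most `η ^ 2 * L ^ 2`
as error; projecting brings the iterate no farther from `u`. The inequality telescopes. -/
theorem ogaConfig_potential (w : Fin N → ℝ) {L : ℝ} (hL : ∀ i, w i ^ 2 ≤ L ^ 2) (η : ℝ)
    (y₁ : cacheSet N C) {u : EuclideanSpace ℝ (Fin N)} (hu : u ∈ cacheSet N C) {T : ℕ}
    (x : Fin T → Fin N) :
    2 * η * ∑ t : Fin T, (utility w (x t) u -
        utility w (x t) (ogaConfig w (fun _ => η) y₁ t fun s => x (s.castLE t.2.le))) +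
      ‖(ogaConfig w (fun _ => η) y₁ T x : EuclideanSpace ℝ (Fin N)) - u‖ ^ 2 ≤
      ‖(y₁ : EuclideanSpace ℝ (Fin N)) - u‖ ^ 2 + T * (η ^ 2 * L ^ 2) := by
  induction T with
  | zero => simp [ogaConfig]
  | succ T ih =>
    set y := ogaConfig w (fun _ => η) y₁ T (Fin.init x) with hy
    have hstep := norm_proj_sub_sq_le
      ((y : EuclideanSpace ℝ (Fin N)) + η • utilityGradient w (x (Fin.last T))) hu
    have hexp : ((y : EuclideanSpace ℝ (Fin N)) + η • utilityGradient w (x (Fin.last T))) - u =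
        η • utilityGradient w (x (Fin.last T)) + ((y : EuclideanSpace ℝ (Fin N)) - u) := by abel
    rw [hexp, norm_add_sq_real, real_inner_smul_left, inner_utilityGradient, utility_sub,
      norm_smul, mul_pow, norm_utilityGradient_sq, Real.norm_eq_abs, sq_abs] at hstep
    have hη := mul_le_mul_of_nonneg_left (hL (x (Fin.last T))) (sq_nonneg η)
    have hlast : ogaConfig w (fun _ => η) y₁ (T + 1) x =
        proj C ((y : EuclideanSpace ℝ (Fin N)) + η • utilityGradient w (x (Fin.last T))) := rfl
    rw [Fin.sum_univ_castSucc, hlast]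
    have ih' := ih (Fin.init x)
    rw [← hy] at ih'
    have hrw : ogaConfig w (fun _ => η) y₁ (Fin.last T)
        (fun s => x (s.castLE (Fin.last T).2.le)) = y := rfl
    rw [hrw, mul_add]
    push_cast
    have hsum : ∑ t : Fin T, (utility w (x t.castSucc) u - utility w (x t.castSucc)
        (ogaConfig w (fun _ => η) y₁ (t.castSucc : Fin (T + 1))
          fun s => x (s.castLE t.castSucc.2.le))) =
        ∑ t : Fin T, (utility w (Fin.init x t) u - utility w (Fin.init x t)
        (ogaConfig w (fun _ => η) y₁ t fun s => Fin.init x (s.castLE t.2.le))) := rfl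
    rw [hsum]
    linarith

theorem trackingLoss_le (w : Fin N → ℝ) (m : (t : ℕ) → (Fin t → Fin N) → cacheSet N C) {T : ℕ}
    (x : Fin T → Fin N) {B : ℝ}
    (hB : ∀ u ∈ cacheSet N C, ∑ t : Fin T, (utility w (x t) u -
        utility w (x t) (m t fun s => x (s.castLE t.2.le))) ≤ B) :
    trackingLoss w m x ≤ B := by
  rw [trackingLoss, sub_le_iff_le_add]
  refine ciSup_le fun u => ?_
  have := hB u u.2
  rw [Finset.sum_sub_distrib] at this
  linarith

theorem regret_ogaTuned_le [NeZero N] (w : Fin N → ℝ) {L : ℝ} (hL0 : 0 < L)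
    (hL : ∀ i, w i ^ 2 ≤ L ^ 2) (T : ℕ) (y₁ : cacheSet N C) :
    regret w T (ogaTuned w L T y₁) ≤ Metric.diam (cacheSet N C) * L * √(T : ℝ) := by
  rw [regret_eq, ogaTuned, oga_eq_detPolicy, meanConfig_detPolicy]
  refine ciSup_le fun x => trackingLoss_le _ _ _ fun u hu => ?_
  set D := Metric.diam (cacheSet N C)
  have hD0 : 0 ≤ D := Metric.diam_nonneg
  have hdist (y : cacheSet N C) : ‖(y : EuclideanSpace ℝ (Fin N)) - u‖ ≤ D := by
    rw [← dist_eq_norm]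
    exact Metric.dist_le_diam_of_mem (isBounded_cacheSet N C) y.2 hu
  rcases Nat.eq_zero_or_pos T with rfl | hT
  · simp
  rcases hD0.eq_or_lt with hD | hD
  -- With zero diameter the stepsize vanishes, but the only configuration is `u` itself.
  · rw [← hD, zero_mul, zero_mul]
    refine Finset.sum_nonpos fun t _ => ?_
    have h0 := hdist (ogaConfig w (fun _ => 0 / (L * √(T : ℝ))) y₁ t
      fun s => x (s.castLE t.2.le))
    rw [← hD, norm_le_zero_iff, sub_eq_zero] at h0
    rw [h0, sub_self]
  · have hs : 0 < √(T : ℝ) := Real.sqrt_pos.2 (Nat.cast_pos.2 hT)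
    set η := D / (L * √(T : ℝ)) with hη
    have hη0 : 0 < η := by positivity
    have h := ogaConfig_potential w hL η y₁ hu x
    have h1 : ‖(y₁ : EuclideanSpace ℝ (Fin N)) - u‖ ^ 2 ≤ D ^ 2 :=
      pow_le_pow_left₀ (norm_nonneg _) (hdist y₁) 2
    -- The stepsize balances the accumulated error against the bound on the initial potential.
    have h2 : (T : ℝ) * (η ^ 2 * L ^ 2) = D ^ 2 := by
      rw [hη]
      field_simp
      rw [Real.sq_sqrt (Nat.cast_nonneg T)]
    have h3 : 2 * η * (D * L * √(T : ℝ)) = 2 * D ^ 2 := by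
      rw [hη]
      field_simp
    refine le_of_mul_le_mul_left (a := 2 * η) ?_ (by positivity)
    rw [h3]
    linarith [sq_nonneg ‖(ogaConfig w (fun _ => η) y₁ T x : EuclideanSpace ℝ (Fin N)) - u‖]

theorem regret_ogaTuned_const_le [NeZero N] {w : ℝ} (hw : 0 < w) (T : ℕ) (y₁ : cacheSet N C) :
    regret (fun _ => w) T (ogaTuned (fun _ => w) w T y₁) ≤
      w * √2 * √((C : ℝ) * (T : ℝ)) := by
  refine (regret_ogaTuned_le _ hw (fun _ => le_rfl) T y₁).trans ?_
  rw [Real.sqrt_mul (Nat.cast_nonneg C)]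
  have h := diam_cacheSet_le N C
  rw [Real.sqrt_mul zero_le_two] at h
  calc _ ≤ (√2 * √C) * w * √(T : ℝ) := by gcongr
    _ = _ := by ring

/-! ### Absolute moments of sums via the central limit theorem. -/

theorem integrable_abs_gaussianReal : Integrable (fun x : ℝ => |x|) (gaussianReal 0 1) :=
  ((memLp_id_gaussianReal (μ := 0) (v := 1) 1).integrable le_rfl).abs

theorem integral_abs_gaussianReal : ∫ x, |x| ∂(gaussianReal 0 1) = √(2 / Real.pi) := by
  have h1 : ∫ x in Set.Ioi (0 : ℝ), x * Real.exp (-x ^ 2 / 2) = 1 := by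
    have h := integral_rpow_mul_exp_neg_mul_rpow (p := 2) (q := 1) (b := 1 / 2) (by norm_num)
      (by norm_num) (by norm_num)
    norm_num at h
    convert h using 4
    ring_nf
  rw [integral_gaussianReal_eq_integral_smul one_ne_zero]
  have h2 : ∀ x : ℝ, gaussianPDFReal 0 1 x • |x| =
      (√(2 * Real.pi))⁻¹ * ((fun y => y * Real.exp (-y ^ 2 / 2)) |x|) := by
    intro x
    simp only [gaussianPDFReal, smul_eq_mul, NNReal.coe_one, mul_one, sub_zero, sq_abs]
    ring
  simp_rw [h2]
  rw [integral_const_mul, integral_comp_abs (f := fun y => y * Real.exp (-y ^ 2 / 2)), h1, mul_one,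
    Real.sqrt_mul zero_le_two, Real.sqrt_div zero_le_two]
  have := Real.sqrt_pos.2 Real.pi_pos
  field_simp
  norm_num

/-- Convergence in distribution controls only bounded test functions; truncating `|x|` high enough
keeps its Gaussian mean above `c`. -/
theorem exists_lt_integral_min_abs_gaussianReal {c : ℝ} (hc : c < √(2 / Real.pi)) :
    ∃ K : ℕ, c < ∫ x, min |x| K ∂(gaussianReal 0 1) := by
  have h : Tendsto (fun K : ℕ => ∫ x, min |x| K ∂(gaussianReal 0 1)) atTop
      (𝓝 (∫ x, |x| ∂(gaussianReal 0 1))) := by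
    refine tendsto_integral_of_dominated_convergence (fun x => |x|)
      (fun K => (by fun_prop : Continuous fun x : ℝ => min |x| (K : ℝ)).aestronglyMeasurable)
      integrable_abs_gaussianReal (fun K => ae_of_all _ fun x => ?_) (ae_of_all _ fun x => ?_)
    · rw [Real.norm_of_nonneg (by positivity)]
      exact min_le_left _ _
    · refine tendsto_const_nhds.congr' ?_
      filter_upwards [eventually_ge_atTop ⌈|x|⌉₊] with K hK
      exact (min_eq_left (Nat.ceil_le.1 hK)).symm
  rw [integral_abs_gaussianReal] at h
  exact (h.eventually (lt_mem_nhds hc)).exists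

/-- A lower bound for absolute first moments from convergence in distribution to a standard
Gaussian variable. -/
theorem eventually_le_integral_abs {Ω : Type*} [MeasurableSpace Ω] {P : Measure Ω}
    [IsProbabilityMeasure P] {Z : ℕ → Ω → ℝ} (hZ : ∀ n, Integrable (Z n) P)
    (h : TendstoInDistribution Z atTop id (fun _ => P) (gaussianReal 0 1)) {c : ℝ}
    (hc : c < √(2 / Real.pi)) : ∀ᶠ n in atTop, c ≤ ∫ ω, |Z n ω| ∂P := by
  obtain ⟨K, hK⟩ := exists_lt_integral_min_abs_gaussianReal hc
  have hcont : Continuous fun x : ℝ => min |x| (K : ℝ) := by fun_prop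
  let f : BoundedContinuousFunction ℝ ℝ :=
    BoundedContinuousFunction.ofNormedAddCommGroup (fun x : ℝ => min |x| (K : ℝ)) hcont K
      fun x => by
        rw [Real.norm_of_nonneg (by positivity)]
        exact min_le_right _ _
  have ht := ProbabilityMeasure.tendsto_iff_forall_integral_tendsto.1 h.tendsto f
  simp only [ProbabilityMeasure.coe_mk, Measure.map_id] at ht
  filter_upwards [ht.eventually (lt_mem_nhds hK)] with n hn
  refine hn.le.trans ?_
  rw [integral_map (hZ n).aemeasurable f.continuous.aestronglyMeasurable]
  refine integral_mono_of_nonneg (ae_of_all _ fun ω => ?_) (hZ n).abs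
    (ae_of_all _ fun ω => min_le_left _ _)
  exact le_min (abs_nonneg _) (Nat.cast_nonneg _)

/-- A lower bound for the average, over all words of length `T` in a finite alphabet, of the
absolute value of a centered and normalized additive function. -/
theorem eventually_le_sum_abs_sum {A : Type*} [Fintype A] [Nonempty A] (h : A → ℝ)
    (h0 : ∑ a, h a = 0) (h2 : ∑ a, h a ^ 2 = Fintype.card A) {c : ℝ} (hc : c < √(2 / Real.pi)) :
    ∀ᶠ T : ℕ in atTop,
      (Fintype.card A : ℝ) ^ T * (c * √T) ≤ ∑ u : Fin T → A, |∑ t, h (u t)| := by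
  let _ : MeasurableSpace A := ⊤
  let μ : Measure A := (PMF.uniformOfFintype A).toMeasure
  have hμ (a : A) : μ.real {a} = (Fintype.card A : ℝ)⁻¹ := by
    rw [Measure.real, PMF.toMeasure_apply_singleton _ _ (.singleton a)]
    simp
  -- Independent uniform letters on one infinite product serve all `T` at once, as the central limit
  -- theorem requires.
  let P : Measure (ℕ → A) := Measure.infinitePi fun _ => μ
  let X : ℕ → (ℕ → A) → ℝ := fun i ω => h (ω i)
  have hh : Measurable h := measurable_from_top
  have hX (i : ℕ) : Measurable (X i) := hh.comp (measurable_pi_apply i)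
  have hcard : (Fintype.card A : ℝ) ≠ 0 := Nat.cast_ne_zero.2 Fintype.card_ne_zero
  have hint (g : A → ℝ) (i : ℕ) :
      ∫ ω, g (ω i) ∂P = (Fintype.card A : ℝ)⁻¹ * ∑ a, g a := by
    have hg : Measurable g := measurable_from_top
    have := integral_map (μ := P) (measurable_pi_apply i).aemeasurable
      hg.aestronglyMeasurable
    rw [Measure.infinitePi_map_eval] at this
    rw [← this, integral_fintype .of_finite, Finset.mul_sum]
    simp [hμ]
  have hindep : iIndepFun X P := iIndepFun_infinitePi (X := fun _ => h) fun _ => hh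
  have hident (i : ℕ) : IdentDistrib (X i) (X 0) P P := by
    have hi : IdentDistrib (fun ω : ℕ → A => ω i) (fun ω => ω 0) P P :=
      ⟨(measurable_pi_apply i).aemeasurable, (measurable_pi_apply 0).aemeasurable, by
        simp only [P]
        rw [Measure.infinitePi_map_eval, Measure.infinitePi_map_eval]⟩
    exact hi.comp hh
  have hm0 : P[X 0] = 0 := by simp [X, hint h, h0]
  have hm2 : P[X 0 ^ 2] = 1 := by
    have := hint (fun a => h a ^ 2) 0
    simpa [X, h2, hcard] using this
  have hXint (i : ℕ) : Integrable (X i) P := by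
    refine Integrable.of_bound (hX i).aestronglyMeasurable (∑ a, ‖h a‖) (ae_of_all _ fun ω => ?_)
    exact Finset.single_le_sum (f := fun a => ‖h a‖) (fun a _ => norm_nonneg _)
      (Finset.mem_univ (ω i))
  have hclt := tendstoInDistribution_inv_sqrt_mul_sum (HasLaw.id (μ := gaussianReal 0 1)) hm0 hm2
    hindep hident
  have hev := eventually_le_integral_abs
    (fun n => (integrable_finsetSum _ fun i _ => hXint i).const_mul _) hclt hc
  filter_upwards [hev, eventually_gt_atTop 0] with T hT hT0
  have hs : 0 < √(T : ℝ) := Real.sqrt_pos.2 (Nat.cast_pos.2 hT0)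
  -- The first `T` letters form a uniform word, which turns the expectation into an average over
  -- words.
  have hword : ∫ ω, |∑ k ∈ Finset.range T, X k ω| ∂P =
      ((Fintype.card A : ℝ) ^ T)⁻¹ * ∑ u : Fin T → A, |∑ t, h (u t)| := by
    have hmap := Measure.map_infinitePi_infinitePi_of_inj (P := fun _ : ℕ => μ)
      (Fin.val_injective (n := T))
    rw [Measure.infinitePi_eq_pi (ι := Fin T)] at hmap
    have hF : Measurable fun u : Fin T → A => |∑ t, h (u t)| := by fun_prop
    have := integral_map (μ := P) (φ := fun ω (i : Fin T) => ω i)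
      (measurable_pi_lambda _ fun i => measurable_pi_apply _).aemeasurable hF.aestronglyMeasurable
    simp only [Finset.sum_range, X]
    rw [← this, hmap, integral_fintype .of_finite, Finset.mul_sum]
    refine Finset.sum_congr rfl fun u _ => ?_
    have hu : (Measure.pi fun _ : Fin T => μ).real {u} = ((Fintype.card A : ℝ) ^ T)⁻¹ := by
      rw [Measure.real, Measure.pi_singleton, ENNReal.toReal_prod]
      simp only [← Measure.real.eq_1, hμ]
      simp
    rw [hu, smul_eq_mul]
  simp only [abs_mul, abs_inv, abs_of_pos hs, integral_const_mul, hword] at hT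
  have hc' : 0 < (Fintype.card A : ℝ) ^ T := by positivity
  field_simp at hT
  linarith

/-! ### Lower bound: random requests to pairs of files. -/

/-- The tower property for uniform words: given its prefix, each letter contributes at most `b` on
average. -/
theorem sum_words_le {A : Type*} [Fintype A] (g : (t : ℕ) → (Fin t → A) → A → ℝ) {b : ℝ}
    (hg : ∀ t p, ∑ a, g t p a ≤ Fintype.card A * b) (T : ℕ) :
    ∑ u : Fin T → A, ∑ t : Fin T, g t (fun s => u (s.castLE t.2.le)) (u t) ≤
      (Fintype.card A : ℝ) ^ T * (T * b) := by
  induction T with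
  | zero => simp
  | succ T ih =>
    rw [← (Fin.snocEquiv fun _ : Fin (T + 1) => A).sum_comp, Fintype.sum_prod_type_right]
    have hstep (u : Fin T → A) (a : A) :
        ∑ t : Fin (T + 1), g t (fun s => (Fin.snocEquiv fun _ : Fin (T + 1) => A) (a, u)
          (s.castLE t.2.le)) ((Fin.snocEquiv fun _ : Fin (T + 1) => A) (a, u) t) =
        ∑ t : Fin T, g t (fun s => u (s.castLE t.2.le)) (u t) + g T u a := by
      rw [Fin.sum_univ_castSucc]
      congr 1
      · refine Finset.sum_congr rfl fun t _ => ?_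
        have h1 : (fun s : Fin t => (Fin.snocEquiv fun _ : Fin (T + 1) => A) (a, u)
            (s.castLE t.castSucc.2.le)) = fun s => u (s.castLE t.2.le) :=
          funext fun s => Fin.snoc_castSucc (α := fun _ => A) a u (s.castLE t.2.le)
        have h2 : (Fin.snocEquiv fun _ : Fin (T + 1) => A) (a, u) t.castSucc = u t :=
          Fin.snoc_castSucc (α := fun _ => A) a u t
        exact congrArg₂ (g t) h1 h2
      · have h1 : (fun s : Fin T => (Fin.snocEquiv fun _ : Fin (T + 1) => A) (a, u)
            (s.castLE (Fin.last T).2.le)) = u :=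
          funext fun s => Fin.snoc_castSucc (α := fun _ => A) a u s
        have h2 : (Fin.snocEquiv fun _ : Fin (T + 1) => A) (a, u) (Fin.last T) = a :=
          Fin.snoc_last (α := fun _ => A) a u
        exact congrArg₂ (g T) h1 h2
    simp_rw [hstep, Finset.sum_add_distrib, Finset.sum_const, Finset.card_univ, nsmul_eq_mul,
      ← Finset.mul_sum]
    have h1 := mul_le_mul_of_nonneg_left ih (Nat.cast_nonneg (α := ℝ) (Fintype.card A))
    have h2 : ∑ u : Fin T → A, ∑ a, g T u a ≤
        (Fintype.card A : ℝ) ^ T * (Fintype.card A * b) := by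
      refine (Finset.sum_le_sum fun u _ => hg T u).trans_eq ?_
      simp
    push_cast
    calc _ ≤ _ := add_le_add h1 h2
      _ = _ := by ring

theorem bddAbove_static (w : Fin N → ℝ) {T : ℕ} (x : Fin T → Fin N) :
    BddAbove (Set.range fun y : cacheSet N C => ∑ t, utility w (x t) y) :=
  (isCompact_range (continuous_finsetSum _ fun t _ =>
    (continuous_utility w (x t)).comp continuous_subtype_val)).bddAbove

/-- The sign with which the letter `a` counts in the comparison of the two letters of the `k`-th
pair. -/
def pairSign (k : Fin C) (a : Fin C × Bool) : ℝ :=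
  if a.1 = k then if a.2 then 1 else -1 else 0

/-- Caching the more requested file of every pair earns `max a b = (a + b) / 2 + |a - b| / 2` on a
pair with counts `a` and `b`, and all counts add up to `T`. -/
theorem le_bestStatic {w : ℝ} (e : Fin C × Bool ↪ Fin N) {T : ℕ} (u : Fin T → Fin C × Bool) :
    w * (T / 2 + (∑ k, |∑ t, pairSign k (u t)|) / 2) ≤
      bestStatic C (fun _ => w) fun t => e (u t) := by
  classical
  let β : Fin C → Bool := fun k => decide (0 ≤ ∑ t, pairSign k (u t))
  let ε : Fin C → ℝ := fun k => if β k then 1 else -1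
  let S : Finset (Fin N) := Finset.univ.image fun k => e (k, β k)
  let y : EuclideanSpace ℝ (Fin N) := WithLp.toLp 2 fun n => if n ∈ S then 1 else 0
  have hy : y ∈ cacheSet N C := by
    refine ⟨fun n => ?_, ?_⟩
    · by_cases h : n ∈ S <;> simp [y, h]
    · have : S.card ≤ C := Finset.card_image_le.trans_eq (Finset.card_fin C)
      simpa [y] using this
  have hmem (a : Fin C × Bool) : e a ∈ S ↔ a.2 = β a.1 := by
    simp only [S, Finset.mem_image, Finset.mem_univ, true_and, e.injective.eq_iff]
    constructor
    · rintro ⟨k, rfl⟩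
      rfl
    · intro h
      exact ⟨a.1, Prod.ext rfl h.symm⟩
  -- Writing the 0-1 configuration through signs makes the total utility linear in the count
  -- differences.
  have hya (a : Fin C × Bool) : y (e a) = 1 / 2 + (∑ k, ε k * pairSign k a) / 2 := by
    have hs : ∑ k, ε k * pairSign k a = ε a.1 * if a.2 then 1 else -1 := by
      rw [Finset.sum_eq_single a.1]
      · simp [pairSign]
      · intro k _ hk
        simp [pairSign, hk.symm]
      · simp
    rw [hs]
    simp only [y, hmem, ε]
    rcases a.2 <;> rcases β a.1 <;> norm_num
  have habs (k : Fin C) : ε k * ∑ t, pairSign k (u t) = |∑ t, pairSign k (u t)| := by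
    by_cases h : 0 ≤ ∑ t, pairSign k (u t)
    · simp [ε, β, h, abs_of_nonneg h]
    · simp [ε, β, h, abs_of_neg (not_le.1 h)]
  refine le_ciSup_of_le (bddAbove_static _ _) ⟨y, hy⟩ (le_of_eq ?_)
  simp only [utility_eq, hya, ← Finset.mul_sum, Finset.sum_add_distrib, ← Finset.sum_div]
  rw [Finset.sum_comm]
  simp only [← Finset.mul_sum, habs]
  simp

/-- The regret dominates the average loss over all words. The left side does not involve `σ`, so the
asymptotic bound is uniform over policies. -/
theorem le_regret [NeZero N] {w : ℝ} (hw : 0 ≤ w) (e : Fin C × Bool ↪ Fin N) (T : ℕ)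
    (σ : CachingPolicy N C) :
    w / 2 * ∑ k : Fin C, ∑ u : Fin T → Fin C × Bool, |∑ t, pairSign k (u t)| ≤
      (Fintype.card (Fin C × Bool) : ℝ) ^ T * regret (fun _ => w) T σ := by
  set m := σ.meanConfig
  have hR (u : Fin T → Fin C × Bool) :
      trackingLoss (fun _ => w) m (fun t => e (u t)) ≤ regret (fun _ => w) T σ := by
    rw [regret_eq]
    exact le_ciSup (f := fun x : Fin T → Fin N => trackingLoss (fun _ => w) σ.meanConfig x)
      (Set.finite_range _).bddAbove _
  have hplay := sum_words_le (A := Fin C × Bool)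
    -- A configuration of total size at most `C` has mean utility at most `w * C / (2 * C)` over the
    -- `2 * C` letters.
    (fun t p a => utility (fun _ => w) (e a) (m t fun s => e (p s))) (b := w / 2) (fun t p => by
      obtain ⟨h1, h2⟩ := (m t fun s => e (p s)).2
      simp only [utility_eq, ← Finset.mul_sum]
      have h3 : ∑ a, (m t fun s => e (p s) : EuclideanSpace ℝ (Fin N)) (e a) ≤
          ∑ n, (m t fun s => e (p s) : EuclideanSpace ℝ (Fin N)) n := by
        rw [← Finset.sum_map Finset.univ e
          fun n => (m t fun s => e (p s) : EuclideanSpace ℝ (Fin N)) n]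
        exact Finset.sum_le_sum_of_subset_of_nonneg (Finset.subset_univ _) fun n _ _ => (h1 n).1
      have := mul_le_mul_of_nonneg_left (h3.trans h2) hw
      simp only [Fintype.card_prod, Fintype.card_fin, Fintype.card_bool]
      push_cast
      linarith) T
  have hsum : ∑ u : Fin T → Fin C × Bool, trackingLoss (fun _ => w) m (fun t => e (u t)) ≤
      (Fintype.card (Fin C × Bool) : ℝ) ^ T * regret (fun _ => w) T σ := by
    refine (Finset.sum_le_sum fun u _ => hR u).trans_eq ?_
    simp
  have hbest := Finset.sum_le_sum fun (u : Fin T → Fin C × Bool) (_ : u ∈ Finset.univ) =>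
    le_bestStatic (w := w) e u
  simp only [trackingLoss, Finset.sum_sub_distrib] at hsum
  rw [← Finset.mul_sum, Finset.sum_add_distrib, ← Finset.sum_div, ← Finset.sum_div] at hbest
  rw [Finset.sum_comm]
  simp only [Finset.sum_const, Finset.card_univ, nsmul_eq_mul, Fintype.card_fun,
    Fintype.card_fin, Nat.cast_pow] at hbest hplay
  linarith

theorem eventually_le_minRegret [NeZero N] {w : ℝ} (hw : 0 ≤ w) (hC : 0 < C) (hCN : 2 * C ≤ N)
    {c : ℝ} (hc : c < √(2 / Real.pi)) :
    ∀ᶠ T : ℕ in atTop, w / 2 * c * √((C : ℝ) * T) ≤ minRegret N C (fun _ => w) T := by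
  classical
  have : NeZero C := ⟨hC.ne'⟩
  obtain ⟨e⟩ : Nonempty (Fin C × Bool ↪ Fin N) :=
    Function.Embedding.nonempty_of_card_le (by simpa [mul_comm] using hCN)
  have hCR : (0 : ℝ) < C := Nat.cast_pos.2 hC
  have hs : 0 < √(C : ℝ) := Real.sqrt_pos.2 hCR
  -- A uniform letter hits pair `k` with probability `1 / C`, so `√C` normalizes the sign to unit
  -- variance.
  have hev (k : Fin C) := eventually_le_sum_abs_sum (fun a => √(C : ℝ) * pairSign k a)
    (by simp [pairSign, Fintype.sum_prod_type])
    (by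
      simp only [mul_pow, Real.sq_sqrt hCR.le, ← Finset.mul_sum, pairSign, Fintype.sum_prod_type]
      simp [ite_pow]) hc
  filter_upwards [eventually_all.2 hev] with T hT
  have : Nonempty (CachingPolicy N C) := ⟨detPolicy fun _ _ => Classical.arbitrary _⟩
  refine le_ciInf fun σ => ?_
  have hA : (0 : ℝ) < (Fintype.card (Fin C × Bool) : ℝ) ^ T :=
    pow_pos (Nat.cast_pos.2 Fintype.card_pos) T
  refine le_of_mul_le_mul_left ?_ hA
  refine le_trans ?_ (le_regret hw e T σ)
  have hk (k : Fin C) : (Fintype.card (Fin C × Bool) : ℝ) ^ T * (c * √T) / √C ≤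
      ∑ u : Fin T → Fin C × Bool, |∑ t, pairSign k (u t)| := by
    rw [div_le_iff₀' hs]
    refine (hT k).trans_eq ?_
    simp [← Finset.mul_sum, abs_mul]
  have hsum := Finset.sum_le_sum fun k (_ : k ∈ Finset.univ) => hk k
  rw [Finset.sum_const, Finset.card_univ, Fintype.card_fin, nsmul_eq_mul] at hsum
  refine le_trans (le_of_eq ?_) (mul_le_mul_of_nonneg_left hsum (by positivity : 0 ≤ w / 2))
  rw [Real.sqrt_mul hCR.le]
  field_simp
  rw [Real.sq_sqrt hCR.le]
  ring

/-! ### Bounds on the minimal regret and the corollary. -/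

theorem minRegret_le [NeZero N] {w : ℝ} (hw : 0 < w) (T : ℕ) :
    minRegret N C (fun _ => w) T ≤ w * √2 * √((C : ℝ) * T) :=
  ((isLeast_minRegret (fun _ => w) T).2
    ⟨ogaTuned (fun _ => w) w T (Classical.arbitrary _), rfl⟩).trans
    (regret_ogaTuned_const_le hw T _)

/-- An empty cache offers no pair for the lower bound; its only configuration is also the best
static one. -/
theorem minRegret_zero_nonneg [NeZero N] (w : Fin N → ℝ) (T : ℕ) :
    0 ≤ minRegret N 0 w T := by
  obtain ⟨σ, hσ⟩ := (isLeast_minRegret (C := 0) w T).1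
  rw [← hσ, regret_eq]
  have : Subsingleton (cacheSet N 0) := ⟨fun y z => Subtype.ext (dist_le_zero.1 (by
    simpa using dist_le_sqrt y.2 z.2))⟩
  refine le_ciSup_of_le (Set.finite_range _).bddAbove 0 ?_
  rw [trackingLoss, sub_nonneg]
  refine le_ciSup_of_le (bddAbove_static w _) (Classical.arbitrary _) (le_of_eq ?_)
  exact Finset.sum_congr rfl fun t _ => by rw [Subsingleton.elim (σ.meanConfig _ _)]

theorem eventually_mul_sqrt_le_minRegret {w : ℝ} (hw : 0 < w) (hCN : (C : ℝ) < N / 2) :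
    ∀ᶠ T : ℕ in atTop, w * √((C : ℝ) / N / Real.pi) * √((C : ℝ) * T) ≤
      minRegret N C (fun _ => w) T := by
  have hN : (0 : ℝ) < N := by linarith [Nat.cast_nonneg (α := ℝ) C]
  have : NeZero N := ⟨(Nat.cast_pos.1 hN).ne'⟩
  rcases Nat.eq_zero_or_pos C with rfl | hC
  · refine .of_forall fun T => ?_
    simpa using minRegret_zero_nonneg (N := N) (fun _ => w) T
  -- After squaring this is `4 * γ < 2`; the strict gap absorbs the passage to the limit.
  have hlt : 2 * √((C : ℝ) / N / Real.pi) < √(2 / Real.pi) := by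
    have h4 : (2 : ℝ) = √(2 ^ 2) := (Real.sqrt_sq zero_le_two).symm
    conv_lhs => rw [h4]
    rw [← Real.sqrt_mul (by norm_num)]
    refine Real.sqrt_lt_sqrt (by positivity) ?_
    rw [← mul_div_assoc]
    refine div_lt_div_of_pos_right ?_ Real.pi_pos
    rw [← mul_div_assoc, div_lt_iff₀ hN]
    linarith
  have hle : 2 * C ≤ N := by
    have : ((2 * C : ℕ) : ℝ) ≤ N := by push_cast; linarith
    exact_mod_cast this
  filter_upwards [eventually_le_minRegret hw.le hC hle hlt] with T hT
  refine le_trans (le_of_eq ?_) hT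
  ring

end OnlineCaching

end

theorem corollary2 (γ w : ℝ) (hw : 0 < w) :
    (∀ N C : ℕ, (C : ℝ) / (N : ℝ) = γ → (C : ℝ) < (N : ℝ) / 2 →
      (∀ T : ℕ, IsLeast (Set.range (OnlineCaching.regret (N := N) (C := C) (fun _ => w) T))
        (OnlineCaching.minRegret N C (fun _ => w) T)) ∧
      (∀ᶠ T : ℕ in Filter.atTop,
        w * √(γ / Real.pi) * √((C : ℝ) * (T : ℝ)) ≤
            OnlineCaching.minRegret N C (fun _ => w) T ∧
          OnlineCaching.minRegret N C (fun _ => w) T ≤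
            w * √2 * √((C : ℝ) * (T : ℝ))) ∧
      (∀ y₁ : OnlineCaching.cacheSet N C, ∀ᶠ T : ℕ in Filter.atTop,
        OnlineCaching.regret (fun _ => w) T (OnlineCaching.ogaTuned (fun _ => w) w T y₁) ≤
          w * √2 * √((C : ℝ) * (T : ℝ)))) ∧
    (∃ c₁ c₂ K : ℝ, 0 < c₁ ∧ 0 < c₂ ∧ 0 < K ∧
      ∀ N C : ℕ, (C : ℝ) / (N : ℝ) = γ → (C : ℝ) < (N : ℝ) / 2 →
        (∀ᶠ T : ℕ in Filter.atTop,
          c₁ * √((C : ℝ) * (T : ℝ)) ≤ OnlineCaching.minRegret N C (fun _ => w) T ∧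
            OnlineCaching.minRegret N C (fun _ => w) T ≤ c₂ * √((C : ℝ) * (T : ℝ))) ∧
        (∀ y₁ : OnlineCaching.cacheSet N C, ∀ᶠ T : ℕ in Filter.atTop,
          OnlineCaching.regret (fun _ => w) T (OnlineCaching.ogaTuned (fun _ => w) w T y₁) ≤
            K * OnlineCaching.minRegret N C (fun _ => w) T)) := by
  have hN0 {N C : ℕ} (h : (C : ℝ) < (N : ℝ) / 2) : NeZero N := by
    refine ⟨fun h0 => ?_⟩
    rw [h0] at h
    have := Nat.cast_nonneg (α := ℝ) C
    norm_num at h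
    linarith
  refine ⟨fun N C hγ hCN => ?_, ?_⟩
  · have := hN0 hCN
    refine ⟨OnlineCaching.isLeast_minRegret _, ?_, fun y₁ =>
      .of_forall fun T => OnlineCaching.regret_ogaTuned_const_le hw T y₁⟩
    filter_upwards [OnlineCaching.eventually_mul_sqrt_le_minRegret hw hCN] with T hT
    exact ⟨hγ ▸ hT, OnlineCaching.minRegret_le hw T⟩
  · have hs : 0 < w * √2 := by positivity
    obtain ⟨c₁, hc₁, hmin⟩ : ∃ c₁ : ℝ, 0 < c₁ ∧ ∀ N C : ℕ, (C : ℝ) / (N : ℝ) = γ →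
        (C : ℝ) < (N : ℝ) / 2 → ∀ᶠ T : ℕ in Filter.atTop,
          c₁ * √((C : ℝ) * (T : ℝ)) ≤ OnlineCaching.minRegret N C (fun _ => w) T := by
      -- For `γ ≤ 0` the cache is empty and `√(C * T)` vanishes, so any positive constant serves.
      rcases lt_or_ge 0 γ with hpos | hneg
      · refine ⟨w * √(γ / Real.pi), by have := Real.pi_pos; positivity, fun N C hγ hCN => ?_⟩
        rw [← hγ]
        exact OnlineCaching.eventually_mul_sqrt_le_minRegret hw hCN
      · refine ⟨1, one_pos, fun N C hγ hCN => .of_forall fun T => ?_⟩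
        have := hN0 hCN
        have hN : (0 : ℝ) < N := Nat.cast_pos.2 (Nat.pos_of_ne_zero (NeZero.ne N))
        have hC : (C : ℝ) ≤ 0 := by
          rw [← hγ, div_le_iff₀ hN, zero_mul] at hneg
          exact hneg
        obtain rfl : C = 0 := by exact_mod_cast hC.antisymm (Nat.cast_nonneg C)
        simpa using OnlineCaching.minRegret_zero_nonneg (fun _ => w) T
    refine ⟨c₁, w * √2, w * √2 / c₁, hc₁, hs, by positivity, fun N C hγ hCN => ?_⟩
    have := hN0 hCN
    refine ⟨?_, fun y₁ => ?_⟩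
    · filter_upwards [hmin N C hγ hCN] with T hT
      exact ⟨hT, OnlineCaching.minRegret_le hw T⟩
    · filter_upwards [hmin N C hγ hCN] with T hT
      refine (OnlineCaching.regret_ogaTuned_const_le hw T y₁).trans ?_
      rw [div_mul_eq_mul_div, le_div_iff₀ hc₁, mul_assoc, mul_comm _ c₁]
      exact mul_le_mul_of_nonneg_left hT hs.le
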